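/- Let $n\ge 1$, $A\in\mathbb{R}^{n\times n}$, $B\in\mathbb{R}^{n\times 1}$, $T>0$ and $N\ge 1$. Let $0\le U_{\min}=U_1<U_2<\dots<U_N=1$, and let $w_1,\dots,w_N\ge 0$ be weights with $w_1>0$ and $w_1+\dots+w_N=1$. For $\xi\in\mathbb{R}^n$ let $\mathcal{U}(\xi)$ be the set of measurable controls $u:[0,T]\to\mathbb{R}$ with $\|u\|_\infty\le 1$ for which the solution of $\dot x(t)=Ax(t)+Bu(t)$, $x(0)=\xi$, satisfies $x(T)=0$. Put $$J(u)=\sum_{i=1}^N w_i\bigl(\|u-U_i\|_1+\|u+U_i\|_1\bigr),\qquad \|v\|_1=\int_0^T|v(t)|\,dt,$$ and call $u\in\mathcal{U}(\xi)$ an SOAV (sum-of-absolute-values) optimal control for $\xi$ if it minimizes $J$ over $\mathcal{U}(\xi)$. Let $$\mathcal{R}=\Bigl\{\int_0^T e^{-At}Bu(t)\,dt:\ u \text{ measurable},\ \|u\|_\infty\le 1\Bigr\},$$ and let $\mathcal{R}_{\min}$ be the set of all $\xi$ for which the optimal value $\min_{u\in\mathcal{U}(\xi)}J(u)$ exists and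 equals $J_{\min}=2T\sum_{i=1}^N w_iU_i$. Assume that $A$ is nonsingular and that $(A,B)$ is controllable, i.e. $[B\ AB\ \cdots\ A^{n-1}B]$ has rank $n$. Then for every $\xi\in\mathcal{R}\setminus\mathcal{R}_{\min}$ there is an SOAV optimal control, and it is unique up to equality almost everywhere on $[0,T]$. In particular, if $U_{\min}=0$, the same holds for every $\xi\in\mathcal{R}$. -/

import Mathlib

open MeasureTheory Set
open scoped Matrix

noncomputable section

namespace SOAV

/-- A measurable control `u` on `[0, T]` whose essential supremum norm satisfies `‖u‖_∞ ≤ r`. -/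
def BoundedControl (T r : ℝ) (u : ℝ → ℝ) : Prop :=
  AEStronglyMeasurable u (volume.restrict (Icc 0 T)) ∧
    eLpNorm u ⊤ (volume.restrict (Icc 0 T)) ≤ ENNReal.ofReal r

/-- `x` is a (Carathéodory) solution on `[0, T]` of `x' = A x + B u`: it is continuous and
satisfies the integrated equation. -/
def IsTrajectory {n : ℕ} (A : Matrix (Fin n) (Fin n) ℝ) (B : Fin n → ℝ) (T : ℝ)
    (u : ℝ → ℝ) (x : ℝ → Fin n → ℝ) : Prop :=
  IntervalIntegrable u volume 0 T ∧
    ContinuousOn x (Icc 0 T) ∧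
    ∀ t ∈ Icc (0 : ℝ) T, x t = x 0 + ∫ s in (0 : ℝ)..t, (A *ᵥ x s + u s • B)

/-- The feasible controls for the initial state `ξ`: `‖u‖_∞ ≤ 1`, and `u` steers the state
from `x 0 = ξ` to `x T = 0`. -/
def feasible {n : ℕ} (A : Matrix (Fin n) (Fin n) ℝ) (B : Fin n → ℝ) (T : ℝ)
    (ξ : Fin n → ℝ) : Set (ℝ → ℝ) :=
  {u | BoundedControl T 1 u ∧ ∃ x, IsTrajectory A B T u x ∧ x 0 = ξ ∧ x T = 0}

/-- The `L¹` norm of a signal on `[0, T]`. -/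
def l1Norm (T : ℝ) (v : ℝ → ℝ) : ℝ := ∫ t in (0 : ℝ)..T, |v t|

/-- The SOAV cost `J(u) = ∑ i, w i (‖u - U i‖₁ + ‖u + U i‖₁)`. -/
def cost {N : ℕ} (T : ℝ) (U w : Fin (N + 1) → ℝ) (u : ℝ → ℝ) : ℝ :=
  ∑ i, w i * (l1Norm T (fun t => u t - U i) + l1Norm T (fun t => u t + U i))

/-- `u` is an SOAV optimal control for the initial state `ξ`. -/
def IsOptimal {n N : ℕ} (A : Matrix (Fin n) (Fin n) ℝ) (B : Fin n → ℝ) (T : ℝ)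
    (U w : Fin (N + 1) → ℝ) (ξ : Fin n → ℝ) (u : ℝ → ℝ) : Prop :=
  u ∈ feasible A B T ξ ∧ ∀ v ∈ feasible A B T ξ, cost T U w u ≤ cost T U w v

/-- The reachable set `R = {∫₀ᵀ e^{-At} B u(t) dt : ‖u‖_∞ ≤ 1}`. -/
def reachable {n : ℕ} (A : Matrix (Fin n) (Fin n) ℝ) (B : Fin n → ℝ) (T : ℝ) :
    Set (Fin n → ℝ) :=
  {ξ | ∃ u, BoundedControl T 1 u ∧
    ξ = ∫ t in (0 : ℝ)..T, u t • (NormedSpace.exp (-(t • A)) *ᵥ B)}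

/-- `J_min = 2 T ∑ i, w i * U i`. -/
def costMin {N : ℕ} (T : ℝ) (U w : Fin (N + 1) → ℝ) : ℝ := 2 * T * ∑ i, w i * U i

/-- `R_min`: the initial states for which the optimal value of the problem (the minimum of the
cost over the feasible controls) equals `J_min`. -/
def reachableMin {n N : ℕ} (A : Matrix (Fin n) (Fin n) ℝ) (B : Fin n → ℝ) (T : ℝ)
    (U w : Fin (N + 1) → ℝ) : Set (Fin n → ℝ) :=
  {ξ | IsLeast (cost T U w '' feasible A B T ξ) (costMin T U w)}

/-- `[B  AB  ⋯  A^{n-1}B]`. -/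
def controllabilityMatrix {n : ℕ} (A : Matrix (Fin n) (Fin n) ℝ) (B : Fin n → ℝ) :
    Matrix (Fin n) (Fin n) ℝ :=
  Matrix.of fun i k => ((A ^ (k : ℕ)) *ᵥ B) i

/-- The pair `(A, B)` is controllable. -/
def Controllable {n : ℕ} (A : Matrix (Fin n) (Fin n) ℝ) (B : Fin n → ℝ) : Prop :=
  (controllabilityMatrix A B).rank = n

/-- There is an SOAV optimal control for `ξ`, and any other one agrees with it almost everywhere
on `[0, T]`. -/
def HasUniqueOptimal {n N : ℕ} (A : Matrix (Fin n) (Fin n) ℝ) (B : Fin n → ℝ) (T : ℝ)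
    (U w : Fin (N + 1) → ℝ) (ξ : Fin n → ℝ) : Prop :=
  ∃ u, IsOptimal A B T U w ξ u ∧
    ∀ v, IsOptimal A B T U w ξ v → v =ᵐ[volume.restrict (Icc 0 T)] u

end SOAV

end

/-!
In the Hilbert space `L²(0, T)` the feasible controls form a bounded closed convex set on which the
cost is convex and lower semicontinuous, so an optimal control `u` exists. The terminal condition
is a linear constraint `∫ e^{-At} B u(t) dt = -ξ` with values in `ℝⁿ`, hence there are Lagrange
multipliers `c ≥ 0` and `p`, and `u(t)` minimizes `c F(s) + s p(e^{-At} B)` over `s ∈ [-1, 1]` for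
almost every `t`, where `F` is the integrand of the cost. If `p = 0`, then `u` minimizes the cost
among all controls, which means `ξ ∈ R_min`. If `p ≠ 0`, then `t ↦ p(e^{-At} B)` is analytic and, by
controllability and invertibility of `A`, not constant, so it takes each value on a null set only;
since `c F(s) + s b` has more than one minimizer for countably many slopes `b` only, `u` is
determined almost everywhere. When a level with positive weight is zero, the only control
minimizing the cost among all controls is `0`, which settles `ξ ∈ R_min`.
-/

open Filter Topology

namespace SOAV

section ConvexOptimization

variable {H : Type*} [NormedAddCommGroup H] [InnerProductSpace ℝ H] [CompleteSpace H]

theorem exists_mem_forall_norm_sub_sq_le {K : Set H} (hne : K.Nonempty) (hcl : IsClosed K)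
    (hconv : Convex ℝ K) : ∃ x ∈ K, ∀ y ∈ K, ‖y - x‖ ^ 2 ≤ ‖y‖ ^ 2 - ‖x‖ ^ 2 := by
  obtain ⟨x, hx, hxmin⟩ := exists_norm_eq_iInf_of_complete_convex hne hcl.isComplete hconv 0
  refine ⟨x, hx, fun y hy => ?_⟩
  have hinner : inner ℝ (0 - x) (y - x) ≤ 0 :=
    (norm_eq_iInf_iff_real_inner_le_zero hconv hx).1 hxmin y hy
  have hsq : ‖x + (y - x)‖ ^ 2 = ‖x‖ ^ 2 + 2 * inner ℝ x (y - x) + ‖y - x‖ ^ 2 :=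
    norm_add_sq_real x (y - x)
  rw [zero_sub, inner_neg_left] at hinner
  rw [add_sub_cancel] at hsq
  linarith

-- The points of minimal norm form a Cauchy sequence, since their norms increase to a finite limit.
theorem nonempty_iInter_of_antitone_convex {K : ℕ → Set H} (hanti : Antitone K)
    (hne : ∀ k, (K k).Nonempty) (hcl : ∀ k, IsClosed (K k)) (hconv : ∀ k, Convex ℝ (K k))
    (hbdd : Bornology.IsBounded (K 0)) : (⋂ k, K k).Nonempty := by
  choose m hmK hm using fun k => exists_mem_forall_norm_sub_sq_le (hne k) (hcl k) (hconv k)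
  have hdist : ∀ i j, i ≤ j → ‖m j - m i‖ ^ 2 ≤ ‖m j‖ ^ 2 - ‖m i‖ ^ 2 :=
    fun i j hij => hm i _ (hanti hij (hmK j))
  have hmono : Monotone fun k => ‖m k‖ ^ 2 := fun i j hij =>
    sub_nonneg.1 ((sq_nonneg _).trans (hdist i j hij))
  obtain ⟨C, hC⟩ := hbdd.exists_norm_le
  have hbound : BddAbove (range fun k => ‖m k‖ ^ 2) := by
    refine ⟨C ^ 2, ?_⟩
    rintro _ ⟨k, rfl⟩
    exact pow_le_pow_left₀ (norm_nonneg _) (hC _ (hanti k.zero_le (hmK k))) 2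
  set ℓ := ⨆ k, ‖m k‖ ^ 2
  have hlim : Tendsto (fun k => √(ℓ - ‖m k‖ ^ 2)) atTop (𝓝 0) := by
    simpa [ℓ] using ((tendsto_atTop_ciSup hmono hbound).const_sub ℓ).sqrt
  have hcauchy : CauchySeq m := by
    refine cauchySeq_of_le_tendsto_0' _ (fun i j hij => Real.le_sqrt_of_sq_le ?_) hlim
    rw [dist_comm, dist_eq_norm]
    exact (hdist i j hij).trans (sub_le_sub_right (le_ciSup hbound j) _)
  obtain ⟨x, hx⟩ := cauchySeq_tendsto_of_complete hcauchy
  refine ⟨x, mem_iInter.2 fun k => (hcl k).mem_of_tendsto hx ?_⟩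
  filter_upwards [eventually_ge_atTop k] with j hj using hanti hj (hmK j)

theorem exists_isMinOn_of_lowerSemicontinuousOn_of_quasiconvexOn {s : Set H} (hne : s.Nonempty)
    (hcl : IsClosed s) (hbdd : Bornology.IsBounded s) {f : H → ℝ}
    (hf : LowerSemicontinuousOn f s) (hfc : QuasiconvexOn ℝ s f) : ∃ x ∈ s, IsMinOn f s x := by
  -- Infima are taken in `EReal`, so that `f` need not be known to be bounded below.
  obtain ⟨r, hr_anti, hr_lim, hr_mem⟩ :=
    exists_seq_tendsto_sInf (hne.image fun x => (f x : EReal)) (OrderBot.bddBelow _)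
  choose y hys hyr using hr_mem
  have hr : ∀ k, r k = f (y k) := fun k => (hyr k).symm
  set K : ℕ → Set H := fun k => {x ∈ s | f x ≤ f (y k)}
  have hanti : Antitone K := fun i j hij x hx =>
    ⟨hx.1, hx.2.trans (EReal.coe_le_coe_iff.1 (by simpa only [hr] using hr_anti hij))⟩
  have hK_closed : ∀ k, IsClosed (K k) := fun k => by
    obtain ⟨v, hv, hsv⟩ := lowerSemicontinuousOn_iff_preimage_Iic.1 hf (f (y k))
    rw [show K k = s ∩ v from hsv]
    exact hcl.inter hv
  obtain ⟨x, hx⟩ := nonempty_iInter_of_antitone_convex hanti (fun k => ⟨y k, hys k, le_rfl⟩)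
    hK_closed (fun k => hfc (f (y k))) (hbdd.subset (sep_subset _ _))
  rw [mem_iInter] at hx
  refine ⟨x, (hx 0).1, fun z hz => EReal.coe_le_coe_iff.1 ?_⟩
  calc (f x : EReal) ≤ sInf ((fun x => (f x : EReal)) '' s) :=
        ge_of_tendsto' hr_lim fun k => (EReal.coe_le_coe (hx k).2).trans_eq (hr k).symm
    _ ≤ f z := sInf_le (mem_image_of_mem _ hz)

variable {V : Type*} [NormedAddCommGroup V] [NormedSpace ℝ V] [FiniteDimensional ℝ V]

theorem exists_ne_zero_forall_le_of_notMem_interior {s : Set V} (hs : Convex ℝ s) {x : V}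
    (hx : x ∈ s) (hxi : x ∉ interior s) : ∃ f : V →ₗ[ℝ] ℝ, f ≠ 0 ∧ ∀ y ∈ s, f x ≤ f y := by
  by_cases hint : (interior s).Nonempty
  · obtain ⟨f, hf, hfs⟩ := geometric_hahn_banach_of_nonempty_interior_point hs hxi hint
    refine ⟨-(f : V →ₗ[ℝ] ℝ), neg_ne_zero.2 fun h => hf (ContinuousLinearMap.coe_injective h),
      fun y hy => neg_le_neg (hfs y hy)⟩
  · have hspan : vectorSpan ℝ s ≠ ⊤ := fun h => hint <|
      hs.interior_nonempty_iff_affineSpan_eq_top.2 <|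
        (AffineSubspace.affineSpan_eq_top_iff_vectorSpan_eq_top_of_nonempty ℝ V V ⟨x, hx⟩).2 h
    obtain ⟨f, hf, hfs⟩ := Submodule.exists_le_ker_of_lt_top _ hspan.lt_top
    refine ⟨f, hf, fun y hy => ?_⟩
    have hyx : f (y - x) = 0 := hfs (vsub_mem_vectorSpan ℝ hy hx)
    rw [map_sub, sub_eq_zero] at hyx
    exact hyx.ge

-- The pair `(p, c)` is a supporting functional of the image of the epigraph of `J` in `V × ℝ`.
theorem exists_lagrange_multiplier {X : Type*} [AddCommGroup X] [Module ℝ X] {C : Set X}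
    {J : X → ℝ} (hJ : ConvexOn ℝ C J) (L : X →ₗ[ℝ] V) {x : X} (hx : x ∈ C)
    (hmin : IsMinOn J {y ∈ C | L y = L x} x) :
    ∃ (c : ℝ) (p : V →ₗ[ℝ] ℝ), 0 ≤ c ∧ (c ≠ 0 ∨ p ≠ 0) ∧
      IsMinOn (fun y => c * J y + p (L y)) C x := by
  set s : Set (V × ℝ) := L.prodMap LinearMap.id '' {z | z.1 ∈ C ∧ J z.1 ≤ z.2}
  have hs_conv : Convex ℝ s := hJ.convex_epigraph.linear_image _
  have mem_s : ∀ y ∈ C, ∀ r, J y ≤ r → (L y, r) ∈ s := fun y hy r hr => ⟨(y, r), ⟨hy, hr⟩, rfl⟩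
  have hx_not_interior : (L x, J x) ∉ interior s := by
    intro h
    have hnhds : ∀ᶠ r in 𝓝 (J x), (L x, r) ∈ s :=
      (Continuous.prodMk_right (L x)).continuousAt.eventually (mem_interior_iff_mem_nhds.1 h)
    obtain ⟨r, ⟨⟨y, r'⟩, ⟨hyC, hyr⟩, hyL⟩, hr : r < J x⟩ :=
      ((hnhds.filter_mono nhdsWithin_le_nhds).and (self_mem_nhdsWithin (s := Iio (J x)))).exists
    obtain ⟨hLy, rfl⟩ := Prod.mk.inj hyL
    exact (hr.trans_le (hmin ⟨hyC, hLy⟩)).not_ge hyr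
  obtain ⟨f, hf0, hf⟩ := exists_ne_zero_forall_le_of_notMem_interior hs_conv
    (mem_s x hx _ le_rfl) hx_not_interior
  have hsplit : ∀ v r, f (v, r) = f (0, 1) * r + f (v, 0) := fun v r => by
    rw [mul_comm, ← smul_eq_mul, ← map_smul, ← map_add]
    simp
  refine ⟨f (0, 1), f ∘ₗ LinearMap.inl ℝ V ℝ, ?_, ?_, fun y hy => ?_⟩
  · have hup := hf _ (mem_s x hx (J x + 1) (by linarith))
    rw [hsplit, hsplit _ (J x + 1)] at hup
    linarith
  · by_contra! h
    refine hf0 (LinearMap.ext fun z => ?_)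
    have hz : f (z.1, 0) = 0 := LinearMap.congr_fun h.2 z.1
    rw [← Prod.mk.eta (p := z), hsplit, h.1, hz, zero_mul, zero_add, LinearMap.zero_apply]
  · have hy' := hf _ (mem_s y hy _ le_rfl)
    rw [hsplit, hsplit (L y)] at hy'
    exact hy'

end ConvexOptimization

section Controls

variable {α : Type*} [MeasurableSpace α] {μ : Measure α} {K : Set ℝ}

/-- The square integrable controls with values almost everywhere in `K`. -/
def controls (μ : Measure α) (K : Set ℝ) : Set (Lp ℝ 2 μ) :=
  {f | ∀ᵐ t ∂μ, f t ∈ K}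

theorem convex_controls (hK : Convex ℝ K) : Convex ℝ (controls μ K) := by
  intro f hf g hg a b ha hb hab
  filter_upwards [hf, hg, Lp.coeFn_add (a • f) (b • g), Lp.coeFn_smul a f, Lp.coeFn_smul b g]
    with t hft hgt hadd hfa hgb
  rw [hadd, Pi.add_apply, hfa, hgb]
  exact hK hft hgt ha hb hab

theorem exists_subseq_tendsto_ae {f : ℕ → Lp ℝ 2 μ} {g : Lp ℝ 2 μ}
    (hf : Tendsto f atTop (𝓝 g)) : ∃ φ : ℕ → ℕ, StrictMono φ ∧
      ∀ᵐ t ∂μ, Tendsto (fun k => f (φ k) t) atTop (𝓝 (g t)) :=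
  (tendstoInMeasure_of_tendsto_Lp hf).exists_seq_tendsto_ae

theorem isClosed_controls (hK : IsClosed K) : IsClosed (controls μ K) := by
  refine isClosed_of_closure_subset fun g hg => ?_
  obtain ⟨f, hf, hfg⟩ := mem_closure_iff_seq_limit.1 hg
  obtain ⟨φ, -, hφ⟩ := exists_subseq_tendsto_ae hfg
  filter_upwards [hφ, ae_all_iff.2 fun k => hf (φ k)] with t ht hft
  exact hK.mem_of_tendsto ht (Eventually.of_forall hft)

variable [IsFiniteMeasure μ]

theorem isBounded_controls (hK : Bornology.IsBounded K) :
    Bornology.IsBounded (controls μ K) := by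
  obtain ⟨C, hC0, hC⟩ := hK.exists_pos_norm_le
  refine isBounded_iff_forall_norm_le.2 ⟨_, fun f hf => Lp.norm_le_of_ae_bound hC0.le ?_⟩
  filter_upwards [hf] with t ht using hC _ ht

theorem exists_mem_controls_ae_eq (hK : Bornology.IsBounded K) {u : α → ℝ}
    (hu : AEStronglyMeasurable u μ) (huK : ∀ᵐ t ∂μ, u t ∈ K) :
    ∃ f ∈ controls μ K, u =ᵐ[μ] f := by
  obtain ⟨C, hC⟩ := hK.exists_norm_le
  have hmem : MemLp u 2 μ := MemLp.of_bound hu C (huK.mono fun t ht => hC _ ht)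
  refine ⟨hmem.toLp u, ?_, hmem.coeFn_toLp.symm⟩
  filter_upwards [hmem.coeFn_toLp, huK] with t ht hut
  rwa [ht]

theorem integrable_comp_of_mem_controls (hK : IsCompact K) {F : ℝ → ℝ} (hF : Continuous F)
    {f : Lp ℝ 2 μ} (hf : f ∈ controls μ K) : Integrable (fun t => F (f t)) μ := by
  obtain ⟨C, hC⟩ := hK.exists_bound_of_continuousOn hF.continuousOn
  exact Integrable.of_bound (hF.comp_aestronglyMeasurable (Lp.aestronglyMeasurable f)) C
    (by filter_upwards [hf] with t ht using hC _ ht)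

theorem continuousOn_integral_comp (hK : IsCompact K) {F : ℝ → ℝ} (hF : Continuous F) :
    ContinuousOn (fun f : Lp ℝ 2 μ => ∫ t, F (f t) ∂μ) (controls μ K) := by
  obtain ⟨C, hC⟩ := hK.exists_bound_of_continuousOn hF.continuousOn
  rw [continuousOn_iff_continuous_domRestrict, continuous_iff_seqContinuous]
  intro f g hfg
  refine tendsto_of_subseq_tendsto fun ns hns => ?_
  obtain ⟨φ, -, hφ⟩ := exists_subseq_tendsto_ae
    ((continuous_subtype_val.tendsto g).comp (hfg.comp hns))
  refine ⟨φ, tendsto_integral_of_dominated_convergence (fun _ => C)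
    (fun k => hF.comp_aestronglyMeasurable (Lp.aestronglyMeasurable _)) (integrable_const C)
    (fun k => by filter_upwards [(f (ns (φ k))).2] with t ht using hC _ ht) ?_⟩
  filter_upwards [hφ] with t ht using (hF.tendsto _).comp ht

theorem convexOn_integral_comp (hK : IsCompact K) (hKc : Convex ℝ K) {F : ℝ → ℝ}
    (hF : Continuous F) (hFc : ConvexOn ℝ K F) :
    ConvexOn ℝ (controls μ K) fun f => ∫ t, F (f t) ∂μ := by
  refine ⟨convex_controls hKc, fun f hf g hg a b ha hb hab => ?_⟩
  have hFf := (integrable_comp_of_mem_controls hK hF hf).smul a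
  have hFg := (integrable_comp_of_mem_controls hK hF hg).smul b
  calc ∫ t, F ((a • f + b • g : Lp ℝ 2 μ) t) ∂μ
      ≤ ∫ t, (a • F (f t) + b • F (g t)) ∂μ := by
        refine integral_mono_ae (integrable_comp_of_mem_controls hK hF
          (convex_controls hKc hf hg ha hb hab)) (hFf.add hFg) ?_
        filter_upwards [hf, hg, Lp.coeFn_add (a • f) (b • g), Lp.coeFn_smul a f,
          Lp.coeFn_smul b g] with t hft hgt hadd hfa hgb
        rw [hadd, Pi.add_apply, hfa, hgb]
        exact hFc.2 hft hgt ha hb hab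
    _ = a • ∫ t, F (f t) ∂μ + b • ∫ t, F (g t) ∂μ := by
        rw [← integral_smul, ← integral_smul]
        exact integral_add hFf hFg

end Controls

section MomentMap

variable {α : Type*} [MeasurableSpace α] {μ : Measure α}
  {V : Type*} [NormedAddCommGroup V] [NormedSpace ℝ V] [CompleteSpace V] {Φ : α → V}

/-- The operator `f ↦ ∫ f Φ`, which sends a control to the state it produces from the impulse
response `Φ`. -/
noncomputable def momentMap (hΦ : MemLp Φ 2 μ) : Lp ℝ 2 μ →L[ℝ] V :=
  ((ContinuousLinearMap.lsmul ℝ ℝ).lpPairing μ 2 2).flip (hΦ.toLp Φ)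

theorem momentMap_apply (hΦ : MemLp Φ 2 μ) (f : Lp ℝ 2 μ) :
    momentMap hΦ f = ∫ t, f t • Φ t ∂μ := by
  rw [momentMap, ContinuousLinearMap.flip_apply, ContinuousLinearMap.lpPairing_eq_integral]
  refine integral_congr_ae ?_
  filter_upwards [hΦ.coeFn_toLp] with t ht
  rw [ht, ContinuousLinearMap.lsmul_apply]

theorem exists_isMinOn_integral_comp [IsFiniteMeasure μ] {K : Set ℝ} (hK : IsCompact K)
    (hKc : Convex ℝ K) {F : ℝ → ℝ} (hF : Continuous F) (hFc : ConvexOn ℝ K F)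
    (hΦ : MemLp Φ 2 μ) {η : V} (hne : {f ∈ controls μ K | momentMap hΦ f = η}.Nonempty) :
    ∃ f ∈ {f ∈ controls μ K | momentMap hΦ f = η},
      IsMinOn (fun f => ∫ t, F (f t) ∂μ) {f ∈ controls μ K | momentMap hΦ f = η} f := by
  have hsub : {f ∈ controls μ K | momentMap hΦ f = η} ⊆ controls μ K := sep_subset _ _
  refine exists_isMinOn_of_lowerSemicontinuousOn_of_quasiconvexOn hne
    ((isClosed_controls hK.isClosed).inter (isClosed_eq (momentMap hΦ).continuous
      continuous_const)) ((isBounded_controls hK.isBounded).subset hsub)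
    ((continuousOn_integral_comp hK hF).mono hsub).lowerSemicontinuousOn
    (((convexOn_integral_comp hK hKc hF hFc).subset hsub ?_).quasiconvexOn)
  exact (convex_controls hKc).inter ((convex_singleton η).is_linear_preimage
    (momentMap hΦ).isLinear)

end MomentMap

section PointwiseMinimization

variable {α : Type*} [MeasurableSpace α] {μ : Measure α} [IsFiniteMeasure μ] {K : Set ℝ}

-- Replacing `f` by `g` on a measurable set cannot decrease the integral.
theorem ae_le_of_isMinOn_integral (hK : Bornology.IsBounded K) {H : α → ℝ → ℝ}
    (hH : ∀ f ∈ controls μ K, Integrable (fun t => H t (f t)) μ) {f g : Lp ℝ 2 μ}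
    (hf : f ∈ controls μ K) (hg : g ∈ controls μ K)
    (hmin : IsMinOn (fun f : Lp ℝ 2 μ => ∫ t, H t (f t) ∂μ) (controls μ K) f) :
    ∀ᵐ t ∂μ, H t (f t) ≤ H t (g t) := by
  classical
  refine ae_le_of_forall_setIntegral_le (hH f hf) (hH g hg) fun s hs _ => ?_
  obtain ⟨h, hh, hfg⟩ : ∃ h ∈ controls μ K, s.piecewise g f =ᵐ[μ] h := by
    refine exists_mem_controls_ae_eq hK ((Lp.aestronglyMeasurable g).restrict.piecewise hs
      (Lp.aestronglyMeasurable f).restrict) ?_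
    filter_upwards [hf, hg] with t hft hgt
    by_cases hts : t ∈ s <;> simp [hts, hft, hgt]
  have hswap : ∫ t, H t (h t) ∂μ = ∫ t in s, H t (g t) ∂μ + ∫ t in sᶜ, H t (f t) ∂μ := by
    rw [← integral_piecewise hs (hH g hg).integrableOn (hH f hf).integrableOn]
    refine integral_congr_ae ?_
    filter_upwards [hfg] with t ht
    by_cases hts : t ∈ s <;> simp [← ht, hts]
  have hle : ∫ t, H t (f t) ∂μ ≤ ∫ t, H t (h t) ∂μ := hmin hh
  rw [hswap, ← integral_add_compl hs (hH f hf)] at hle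
  exact le_of_add_le_add_right hle

theorem ae_isMinOn_of_isMinOn_integral (hK : Bornology.IsBounded K) {H : α → ℝ → ℝ}
    (hHc : ∀ t, Continuous (H t))
    (hH : ∀ f ∈ controls μ K, Integrable (fun t => H t (f t)) μ) {f : Lp ℝ 2 μ}
    (hf : f ∈ controls μ K)
    (hmin : IsMinOn (fun f : Lp ℝ 2 μ => ∫ t, H t (f t) ∂μ) (controls μ K) f) :
    ∀ᵐ t ∂μ, IsMinOn (H t) K (f t) := by
  obtain ⟨D, hDK, hD, hKD⟩ :=
    (TopologicalSpace.IsSeparable.of_separableSpace K).exists_countable_dense_subset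
  have hconst : ∀ c ∈ D, ∀ᵐ t ∂μ, H t (f t) ≤ H t c := fun c hc => by
    obtain ⟨g, hg, hcg⟩ := exists_mem_controls_ae_eq (μ := μ) hK
      (aestronglyMeasurable_const (b := c)) (ae_of_all _ fun _ => hDK hc)
    filter_upwards [hcg, ae_le_of_isMinOn_integral hK hH hf hg hmin] with t ht hle
    rwa [← ht] at hle
  filter_upwards [(ae_ball_iff hD).2 hconst] with t ht s hs
  exact (isClosed_le continuous_const (hHc t)).closure_subset_iff.2 ht (hKD hs)

-- A convex function with two minimizers is constant between them, so its slope `-x` there is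
-- a difference quotient of `G` at two rational points.
theorem countable_setOf_nontrivial_argmin {G : ℝ → ℝ} (hG : ConvexOn ℝ K G) :
    {x | {s ∈ K | IsMinOn (fun s => G s + s * x) K s}.Nontrivial}.Countable := by
  refine (countable_range fun r : ℚ × ℚ => -slope G r.1 r.2).mono fun x hx => ?_
  obtain ⟨a, ⟨haK, ha⟩, b, ⟨hbK, hb⟩, hab⟩ := hx.exists_lt
  have hconv : Convex ℝ {s ∈ K | G s + s * x ≤ G a + a * x} :=
    (hG.add ((LinearMap.mulRight ℝ x).convexOn hG.1)).quasiconvexOn _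
  have hconst : ∀ s ∈ Icc a b, G s + s * x = G a + a * x := fun s hs => by
    obtain ⟨hsK, hle⟩ := hconv.ordConnected.out ⟨haK, le_rfl⟩ ⟨hbK, hb haK⟩ hs
    exact hle.antisymm (ha hsK)
  obtain ⟨r₁, har₁, hr₁b⟩ := exists_rat_btwn hab
  obtain ⟨r₂, hr₁₂, hr₂b⟩ := exists_rat_btwn hr₁b
  refine ⟨(r₁, r₂), ?_⟩
  have h₁ := hconst r₁ ⟨har₁.le, hr₁b.le⟩
  have h₂ := hconst r₂ ⟨(har₁.trans hr₁₂).le, hr₂b.le⟩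
  have hne : (r₂ : ℝ) - r₁ ≠ 0 := sub_ne_zero.2 hr₁₂.ne'
  simp only [slope_def_field]
  field_simp
  linarith

theorem eq_of_isMinOn_integral_add_mul (hK : IsCompact K) {G : ℝ → ℝ} (hG : Continuous G)
    (hGc : ConvexOn ℝ K G) {q : α → ℝ} (hq : MemLp q 2 μ) (hq_level : ∀ c, ∀ᵐ t ∂μ, q t ≠ c)
    {f g : Lp ℝ 2 μ} (hf : f ∈ controls μ K) (hg : g ∈ controls μ K)
    (hfmin : IsMinOn (fun f : Lp ℝ 2 μ => ∫ t, (G (f t) + f t * q t) ∂μ) (controls μ K) f)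
    (hgmin : IsMinOn (fun f : Lp ℝ 2 μ => ∫ t, (G (f t) + f t * q t) ∂μ) (controls μ K) g) :
    f = g := by
  have hcont : ∀ t, Continuous fun s => G s + s * q t := fun t => by fun_prop
  have hint : ∀ f ∈ controls μ K, Integrable (fun t => G (f t) + f t * q t) μ := fun f hf =>
    (integrable_comp_of_mem_controls hK hG hf).add ((Lp.memLp f).integrable_mul hq)
  refine Lp.ext ?_
  filter_upwards [hf, hg,
    ae_isMinOn_of_isMinOn_integral hK.isBounded hcont hint hf hfmin,
    ae_isMinOn_of_isMinOn_integral hK.isBounded hcont hint hg hgmin,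
    (ae_ball_iff (countable_setOf_nontrivial_argmin hGc)).2 fun c _ => hq_level c]
    with t hft hgt hfm hgm hqt
  exact not_nontrivial_iff.1 (fun h => hqt _ h rfl) ⟨hft, hfm⟩ ⟨hgt, hgm⟩

variable {V : Type*} [NormedAddCommGroup V] [NormedSpace ℝ V] {Φ : α → V}

theorem integral_comp_add_momentMap [CompleteSpace V] (hK : IsCompact K) {G : ℝ → ℝ}
    (hG : Continuous G) (hΦ : MemLp Φ 2 μ) (p : V →L[ℝ] ℝ) {f : Lp ℝ 2 μ}
    (hf : f ∈ controls μ K) :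
    ∫ t, (G (f t) + f t * p (Φ t)) ∂μ = ∫ t, G (f t) ∂μ + p (momentMap hΦ f) := by
  have hfΦ : Integrable (fun t => f t • Φ t) μ := (hΦ.smul (Lp.memLp f)).integrable le_rfl
  rw [momentMap_apply, ← p.integral_comp_comm hfΦ]
  simp only [map_smul, smul_eq_mul]
  exact integral_add (integrable_comp_of_mem_controls hK hG hf)
    ((Lp.memLp f).integrable_mul (p.comp_memLp' hΦ))

theorem eq_of_isMinOn_of_not_isMinOn_controls [FiniteDimensional ℝ V] (hK : IsCompact K)
    (hKc : Convex ℝ K) {F : ℝ → ℝ} (hF : Continuous F) (hFc : ConvexOn ℝ K F) (hΦ : MemLp Φ 2 μ)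
    (hΦ_level : ∀ p : V →ₗ[ℝ] ℝ, p ≠ 0 → ∀ c, ∀ᵐ t ∂μ, p (Φ t) ≠ c) {η : V} {f g : Lp ℝ 2 μ}
    (hf : f ∈ {f ∈ controls μ K | momentMap hΦ f = η})
    (hg : g ∈ {f ∈ controls μ K | momentMap hΦ f = η})
    (hfmin : IsMinOn (fun f => ∫ t, F (f t) ∂μ) {f ∈ controls μ K | momentMap hΦ f = η} f)
    (hgmin : IsMinOn (fun f => ∫ t, F (f t) ∂μ) {f ∈ controls μ K | momentMap hΦ f = η} g)
    (hglobal : ¬ IsMinOn (fun f => ∫ t, F (f t) ∂μ) (controls μ K) f) : f = g := by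
  obtain ⟨hfC, rfl⟩ := hf
  obtain ⟨hgC, hgf⟩ := hg
  have hcost : ∫ t, F (f t) ∂μ = ∫ t, F (g t) ∂μ :=
    (hfmin ⟨hgC, hgf⟩).antisymm (hgmin ⟨hfC, rfl⟩)
  obtain ⟨c, p, hc, hcp, hmult⟩ := exists_lagrange_multiplier
    (convexOn_integral_comp hK hKc hF hFc) (momentMap hΦ : Lp ℝ 2 μ →ₗ[ℝ] V) hfC hfmin
  have hp : p ≠ 0 := by
    rintro rfl
    have hc' : 0 < c := hc.lt_of_ne' (hcp.resolve_right (not_ne_iff.2 rfl))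
    refine hglobal fun h hh => le_of_mul_le_mul_left ?_ hc'
    simpa using hmult hh
  set P : V →L[ℝ] ℝ := LinearMap.toContinuousLinearMap p
  have hlagrangian : ∀ h ∈ controls μ K, ∫ t, (c * F (h t) + h t * P (Φ t)) ∂μ =
      c * ∫ t, F (h t) ∂μ + p (momentMap hΦ h) := fun h hh => by
    rw [integral_comp_add_momentMap hK (G := fun s => c * F s) (by fun_prop) hΦ P hh,
      integral_const_mul]
    rfl
  refine eq_of_isMinOn_integral_add_mul hK (hF.const_mul c) (hFc.smul hc) (P.comp_memLp' hΦ)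
    (hΦ_level p hp) hfC hgC (fun h hh => ?_) (fun h hh => ?_)
  · have := hmult hh
    simpa [hlagrangian _ hh, hlagrangian _ hfC] using this
  · have := hmult hh
    simpa [hlagrangian _ hh, hlagrangian _ hgC, ← hcost, hgf] using this

end PointwiseMinimization

section IntegrationByParts

variable {a b : ℝ}

theorem continuousOn_of_eq_add_integral {E : Type*} [NormedAddCommGroup E] [NormedSpace ℝ E]
    {x f : ℝ → E} (hf : IntervalIntegrable f volume a b)
    (hx : ∀ s ∈ uIcc a b, x s = x a + ∫ r in a..s, f r) : ContinuousOn x (uIcc a b) :=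
  (continuousOn_const.add (intervalIntegral.continuousOn_primitive_interval' hf
    left_mem_uIcc)).congr hx

theorem integral_deriv_mul_add_mul {m m' x f : ℝ → ℝ} (hm : ∀ s, HasDerivAt m (m' s) s)
    (hm' : Continuous m') (hf : IntervalIntegrable f volume a b)
    (hx : ∀ s ∈ uIcc a b, x s = x a + ∫ r in a..s, f r) :
    ∫ s in a..b, (m' s * x s + m s * f s) = m b * x b - m a * x a := by
  have hderiv : deriv m = m' := funext fun s => (hm s).deriv
  have hm_ac : AbsolutelyContinuousOnInterval m a b :=
    (contDiff_one_iff_deriv.2 ⟨fun s => (hm s).differentiableAt, hderiv ▸ hm'⟩).contDiffOn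
      |>.absolutelyContinuousOnInterval
  set X : ℝ → ℝ := fun s => x a + ∫ r in a..s, f r
  have hX_ac : AbsolutelyContinuousOnInterval X a b :=
    contDiffOn_const.absolutelyContinuousOnInterval.add
      (hf.absolutelyContinuousOnInterval_intervalIntegral left_mem_uIcc)
  have hxa : x a = X a := hx a left_mem_uIcc
  have hxb : x b = X b := hx b right_mem_uIcc
  rw [hxa, hxb, ← hm_ac.integral_deriv_mul_eq_sub hX_ac]
  refine intervalIntegral.integral_congr_ae ?_
  filter_upwards [hf.ae_hasDerivAt_integral] with s hs hsab
  have hs_mem : s ∈ uIcc a b := uIoc_subset_uIcc hsab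
  have hXs : HasDerivAt X (f s) s := (hs hs_mem a left_mem_uIcc).const_add (x a)
  rw [hderiv, hXs.deriv, hx s hs_mem]

variable {m n : Type*} [Fintype m] [Fintype n]

theorem intervalIntegral_eval {f : ℝ → n → ℝ}
    (hf : ∀ i, IntervalIntegrable (fun s => f s i) volume a b) (i : n) :
    (∫ s in a..b, f s) i = ∫ s in a..b, f s i := by
  rw [intervalIntegral, intervalIntegral, Pi.sub_apply, eval_integral fun i => (hf i).1,
    eval_integral fun i => (hf i).2]

theorem integral_deriv_mulVec_add_mulVec {M M' : ℝ → Matrix m n ℝ} {x f : ℝ → n → ℝ}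
    (hM : ∀ i j s, HasDerivAt (fun s => M s i j) (M' s i j) s) (hM' : Continuous M')
    (hf : IntervalIntegrable f volume a b)
    (hx : ∀ s ∈ uIcc a b, x s = x a + ∫ r in a..s, f r) :
    ∫ s in a..b, (M' s *ᵥ x s + M s *ᵥ f s) = M b *ᵥ x b - M a *ᵥ x a := by
  have hf_eval : ∀ j, IntervalIntegrable (fun s => f s j) volume a b := fun j =>
    ⟨hf.1.eval j, hf.2.eval j⟩
  have hx_eval : ∀ j, ∀ s ∈ uIcc a b, x s j = x a j + ∫ r in a..s, f r j := fun j s hs => by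
    rw [hx s hs, Pi.add_apply, intervalIntegral_eval fun j =>
      (hf_eval j).mono_set (uIcc_subset_uIcc left_mem_uIcc hs)]
  have hterm : ∀ i j, IntervalIntegrable (fun s => M' s i j * x s j + M s i j * f s j)
      volume a b := fun i j =>
    ((hM'.matrix_elem i j).continuousOn.mul
      (continuousOn_of_eq_add_integral (hf_eval j) (hx_eval j))).intervalIntegrable.add
      ((hf_eval j).continuousOn_mul fun s _ => (hM i j s).continuousAt.continuousWithinAt)
  have hsum : ∀ i s, (M' s *ᵥ x s + M s *ᵥ f s) i =
      ∑ j, (M' s i j * x s j + M s i j * f s j) := fun i s =>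
    Finset.sum_add_distrib.symm
  ext i
  rw [intervalIntegral_eval fun i => ?_]
  · simp only [hsum]
    rw [intervalIntegral.integral_finsetSum fun j _ => hterm i j]
    simp only [integral_deriv_mul_add_mul (hM i _) (hM'.matrix_elem i _) (hf_eval _) (hx_eval _)]
    exact Finset.sum_sub_distrib _ _
  · simp only [hsum]
    simpa only [Finset.sum_fn] using IntervalIntegrable.sum Finset.univ fun j _ => hterm i j

end IntegrationByParts

section MatrixExponential

variable {n : ℕ} (A : Matrix (Fin n) (Fin n) ℝ) {E : Type*} [NormedAddCommGroup E]
  [NormedSpace ℝ E]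

open scoped Matrix.Norms.Operator in
theorem hasDerivAt_linearMap_exp (L : Matrix (Fin n) (Fin n) ℝ →ₗ[ℝ] E) (t : ℝ) :
    HasDerivAt (fun t : ℝ => L (NormedSpace.exp (t • A))) (L (NormedSpace.exp (t • A) * A)) t :=
  (LinearMap.toContinuousLinearMap L).hasFDerivAt.comp_hasDerivAt t
    (hasDerivAt_exp_smul_const A t)

open scoped Matrix.Norms.Operator in
theorem analyticAt_linearMap_exp (L : Matrix (Fin n) (Fin n) ℝ →ₗ[ℝ] E) (t : ℝ) :
    AnalyticAt ℝ (fun t : ℝ => L (NormedSpace.exp (t • A))) t :=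
  ((LinearMap.toContinuousLinearMap L).analyticAt _).comp <|
    AnalyticAt.comp (f := fun t : ℝ => t • A) (NormedSpace.exp_analytic (𝕂 := ℝ) (t • A))
      (analyticAt_id.smul analyticAt_const)

theorem hasDerivAt_exp_smul_apply (i j : Fin n) (t : ℝ) :
    HasDerivAt (fun t : ℝ => NormedSpace.exp (t • A) i j) ((NormedSpace.exp (t • A) * A) i j) t :=
  hasDerivAt_linearMap_exp A (Matrix.entryLinearMap ℝ ℝ i j) t

theorem continuous_exp_smul : Continuous fun t : ℝ => NormedSpace.exp (t • A) :=
  continuous_matrix fun i j => continuous_iff_continuousAt.2 fun t =>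
    (hasDerivAt_exp_smul_apply A i j t).continuousAt

open scoped Matrix.Norms.Operator in
theorem commute_exp_smul (t : ℝ) : Commute (NormedSpace.exp (t • A)) A :=
  ((Commute.refl A).smul_left t).exp_left

theorem exp_smul_mul_exp_neg_smul (t : ℝ) :
    NormedSpace.exp (t • A) * NormedSpace.exp (-(t • A)) = 1 := by
  rw [← Matrix.exp_add_of_commute _ _ (Commute.refl (t • A)).neg_right, add_neg_cancel,
    NormedSpace.exp_zero]

end MatrixExponential

section ImpulseResponse

variable {n : ℕ} (A : Matrix (Fin n) (Fin n) ℝ) (B : Fin n → ℝ)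

/-- The function `t ↦ e^{-At} B`, against which controls are integrated in the definition of the
reachable set. -/
noncomputable def impulseResponse (t : ℝ) : Fin n → ℝ := NormedSpace.exp (-(t • A)) *ᵥ B

theorem impulseResponse_eq_mulVecBilin : impulseResponse A B =
    fun t => (Matrix.mulVecBilin ℝ ℝ).flip B (NormedSpace.exp (t • -A)) := by
  simp only [smul_neg]
  rfl

theorem hasDerivAt_impulseResponse (t : ℝ) :
    HasDerivAt (impulseResponse A B) (-impulseResponse A (A *ᵥ B) t) t := by
  have hderiv : -impulseResponse A (A *ᵥ B) t =
      (Matrix.mulVecBilin ℝ ℝ).flip B (NormedSpace.exp (t • -A) * -A) := by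
    simp [impulseResponse, Matrix.mulVec_mulVec]
  rw [hderiv, impulseResponse_eq_mulVecBilin]
  exact hasDerivAt_linearMap_exp (-A) ((Matrix.mulVecBilin ℝ ℝ).flip B) t

theorem analyticAt_impulseResponse (t : ℝ) : AnalyticAt ℝ (impulseResponse A B) t := by
  rw [impulseResponse_eq_mulVecBilin]
  exact analyticAt_linearMap_exp (-A) ((Matrix.mulVecBilin ℝ ℝ).flip B) t

theorem continuous_impulseResponse : Continuous (impulseResponse A B) :=
  continuous_iff_continuousAt.2 fun t => (hasDerivAt_impulseResponse A B t).continuousAt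

theorem exp_smul_mulVec_impulseResponse (t : ℝ) :
    NormedSpace.exp (t • A) *ᵥ impulseResponse A B t = B := by
  rw [impulseResponse, Matrix.mulVec_mulVec, exp_smul_mul_exp_neg_smul, Matrix.one_mulVec]

variable {A B} {T : ℝ} {u : ℝ → ℝ}

theorem IsTrajectory.exp_neg_smul_mulVec_eq {x : ℝ → Fin n → ℝ} (hx : IsTrajectory A B T u x)
    {t : ℝ} (ht : t ∈ Icc 0 T) :
    NormedSpace.exp (-(t • A)) *ᵥ x t = x 0 + ∫ s in (0 : ℝ)..t, u s • impulseResponse A B s := by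
  obtain ⟨hu, hxc, hx⟩ := hx
  have hsub : uIcc 0 t ⊆ Icc 0 T := uIcc_of_le ht.1 ▸ Icc_subset_Icc_right ht.2
  have hu' : IntervalIntegrable u volume 0 t :=
    hu.mono_set (hsub.trans_eq (uIcc_of_le (ht.1.trans ht.2)).symm)
  have hf : IntervalIntegrable (fun s => A *ᵥ x s + u s • B) volume 0 t :=
    ((Continuous.matrix_mulVec continuous_const continuous_id).comp_continuousOn
      (hxc.mono hsub)).intervalIntegrable.add ⟨hu'.1.smul_const B, hu'.2.smul_const B⟩
  have hparts := integral_deriv_mulVec_add_mulVec (hasDerivAt_exp_smul_apply (-A))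
    ((continuous_exp_smul (-A)).matrix_mul continuous_const) hf fun s hs => hx s (hsub hs)
  simp only [Matrix.mulVec_add, Matrix.mulVec_mulVec, mul_neg, Matrix.neg_mulVec,
    neg_add_cancel_left, Matrix.mulVec_smul, smul_neg, zero_smul, neg_zero, NormedSpace.exp_zero,
    Matrix.one_mulVec] at hparts
  exact eq_add_of_sub_eq' hparts.symm

theorem isTrajectory_exp_smul_mulVec (hT : 0 ≤ T) (hu : IntervalIntegrable u volume 0 T)
    (ξ : Fin n → ℝ) :
    IsTrajectory A B T u fun t =>
      NormedSpace.exp (t • A) *ᵥ (ξ + ∫ s in (0 : ℝ)..t, u s • impulseResponse A B s) := by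
  set y : ℝ → Fin n → ℝ := fun t => ξ + ∫ s in (0 : ℝ)..t, u s • impulseResponse A B s
  have hf : IntervalIntegrable (fun s => u s • impulseResponse A B s) volume 0 T :=
    hu.smul_continuousOn (continuous_impulseResponse A B).continuousOn
  have hy : ∀ t, y t = y 0 + ∫ s in (0 : ℝ)..t, u s • impulseResponse A B s := fun t => by
    simp [y]
  have hyc : ContinuousOn y (Icc 0 T) :=
    uIcc_of_le hT ▸ continuousOn_of_eq_add_integral hf fun s _ => hy s
  refine ⟨hu, (Continuous.matrix_mulVec continuous_fst continuous_snd).comp_continuousOn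
    ((continuous_exp_smul A).continuousOn.prodMk hyc), fun t ht => ?_⟩
  have hsub : uIcc 0 t ⊆ uIcc 0 T :=
    uIcc_subset_uIcc left_mem_uIcc (uIcc_of_le hT ▸ ht)
  have hparts := integral_deriv_mulVec_add_mulVec (hasDerivAt_exp_smul_apply A)
    ((continuous_exp_smul A).matrix_mul continuous_const) (hf.mono_set hsub) fun s _ => hy s
  simp only [(commute_exp_smul A _).eq, Matrix.mulVec_smul, exp_smul_mulVec_impulseResponse,
    ← Matrix.mulVec_mulVec] at hparts
  exact eq_add_of_sub_eq' hparts.symm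

theorem exists_isTrajectory_iff (hT : 0 ≤ T) (hu : IntervalIntegrable u volume 0 T)
    {ξ : Fin n → ℝ} :
    (∃ x, IsTrajectory A B T u x ∧ x 0 = ξ ∧ x T = 0) ↔
      ∫ t in (0 : ℝ)..T, u t • impulseResponse A B t = -ξ := by
  constructor
  · rintro ⟨x, hx, rfl, hxT⟩
    have h := hx.exp_neg_smul_mulVec_eq (right_mem_Icc.2 hT)
    rw [hxT, Matrix.mulVec_zero] at h
    exact eq_neg_of_add_eq_zero_right h.symm
  · intro hξ
    exact ⟨_, isTrajectory_exp_smul_mulVec hT hu ξ, by simp, by simp [hξ]⟩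

end ImpulseResponse

section Controllability

variable {n : ℕ} {A : Matrix (Fin n) (Fin n) ℝ} {B : Fin n → ℝ}

theorem Controllable.mulVec (hA : IsUnit A) (hAB : Controllable A B) :
    Controllable A (A *ᵥ B) := by
  have hmul : controllabilityMatrix A (A *ᵥ B) = A * controllabilityMatrix A B := by
    ext i k
    change ((A ^ (k : ℕ)) *ᵥ (A *ᵥ B)) i = (A *ᵥ ((A ^ (k : ℕ)) *ᵥ B)) i
    rw [Matrix.mulVec_mulVec, Matrix.mulVec_mulVec, ← pow_succ, pow_succ']
  rw [Controllable, hmul,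
    Matrix.rank_mul_eq_right_of_isUnit_det _ _ ((Matrix.isUnit_iff_isUnit_det A).1 hA)]
  exact hAB

theorem Controllable.eq_zero_of_forall_pow (hAB : Controllable A B) {p : (Fin n → ℝ) →ₗ[ℝ] ℝ}
    (hp : ∀ k : ℕ, p ((A ^ k) *ᵥ B) = 0) : p = 0 := by
  have hspan : Submodule.span ℝ (range (controllabilityMatrix A B).col) = ⊤ := by
    refine Submodule.eq_top_of_finrank_eq ?_
    rw [← Matrix.rank_eq_finrank_span_cols, Module.finrank_fin_fun]
    exact hAB
  refine LinearMap.ext_on hspan ?_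
  rintro _ ⟨k, rfl⟩
  exact hp k

theorem apply_impulseResponse_pow_eq_zero {p : (Fin n → ℝ) →ₗ[ℝ] ℝ} {c : ℝ}
    (hc : ∀ t, p (impulseResponse A B t) = c) (k : ℕ) :
    ∀ t, p (impulseResponse A ((A ^ k) *ᵥ (A *ᵥ B)) t) = 0 := by
  have hstep : ∀ (v : Fin n → ℝ) (d : ℝ), (∀ t, p (impulseResponse A v t) = d) →
      ∀ t, p (impulseResponse A (A *ᵥ v) t) = 0 := fun v d hd t => by
    have hderiv : HasDerivAt (fun t => p (impulseResponse A v t))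
        (p (-impulseResponse A (A *ᵥ v) t)) t :=
      (LinearMap.toContinuousLinearMap p).hasFDerivAt.comp_hasDerivAt t
        (hasDerivAt_impulseResponse A v t)
    rw [funext hd, map_neg] at hderiv
    exact neg_eq_zero.1 (hderiv.unique (hasDerivAt_const t d))
  induction k with
  | zero => simpa using hstep B c hc
  | succ k ih =>
    rw [pow_succ', ← Matrix.mulVec_mulVec]
    exact hstep _ 0 ih

theorem Controllable.exists_apply_impulseResponse_ne (hA : IsUnit A) (hAB : Controllable A B)
    {p : (Fin n → ℝ) →ₗ[ℝ] ℝ} (hp : p ≠ 0) (c : ℝ) : ∃ t, p (impulseResponse A B t) ≠ c := by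
  by_contra! hc
  refine hp ((hAB.mulVec hA).eq_zero_of_forall_pow fun k => ?_)
  simpa [impulseResponse] using apply_impulseResponse_pow_eq_zero hc k 0

theorem Controllable.ae_apply_impulseResponse_ne (hA : IsUnit A) (hAB : Controllable A B)
    {p : (Fin n → ℝ) →ₗ[ℝ] ℝ} (hp : p ≠ 0) (c : ℝ) :
    ∀ᵐ t, p (impulseResponse A B t) ≠ c := by
  have han : AnalyticOnNhd ℝ (fun t => p (impulseResponse A B t) - c) univ := fun t _ =>
    (((LinearMap.toContinuousLinearMap p).analyticAt _).comp
      (analyticAt_impulseResponse A B t)).sub analyticAt_const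
  obtain ⟨t₀, ht₀⟩ := hAB.exists_apply_impulseResponse_ne hA hp c
  have hnull := ae_restrict_le_codiscreteWithin (μ := (volume : Measure ℝ)) MeasurableSet.univ
    (han.preimage_zero_mem_codiscrete (sub_ne_zero.2 ht₀))
  rw [Measure.restrict_univ] at hnull
  filter_upwards [hnull] with t ht using sub_ne_zero.1 ht

end Controllability

section CostDensity

variable {ι : Type*} [Fintype ι] {U w : ι → ℝ}

/-- The integrand `s ↦ ∑ i, w i (|s - U i| + |s + U i|)` of the SOAV cost. -/
def costDensity (U w : ι → ℝ) (s : ℝ) : ℝ := ∑ i, w i * (|s - U i| + |s + U i|)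

theorem continuous_costDensity : Continuous (costDensity U w) := by
  unfold costDensity
  fun_prop

theorem convexOn_costDensity (hw : ∀ i, 0 ≤ w i) {s : Set ℝ} (hs : Convex ℝ s) :
    ConvexOn ℝ s (costDensity U w) := by
  have hsum : costDensity U w = ∑ i, fun s => w i * (dist s (U i) + dist s (-U i)) := by
    ext s
    simp [costDensity, Real.dist_eq]
  rw [hsum]
  exact Finset.sum_induction _ _ (fun _ _ => ConvexOn.add) (convexOn_const 0 hs) fun i _ =>
    ((convexOn_dist (U i) hs).add (convexOn_dist (-U i) hs)).smul (hw i)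

theorem two_mul_abs_le_abs_sub_add_abs_add (s c : ℝ) : 2 * |c| ≤ |s - c| + |s + c| := by
  rcases abs_cases c with ⟨hc, -⟩ | ⟨hc, -⟩
  · linarith [neg_abs_le (s - c), le_abs_self (s + c)]
  · linarith [le_abs_self (s - c), neg_abs_le (s + c)]

theorem costDensity_zero : costDensity U w 0 = ∑ i, w i * (2 * |U i|) := by
  simp only [costDensity, zero_sub, zero_add, abs_neg, two_mul]

theorem costDensity_zero_le (hw : ∀ i, 0 ≤ w i) (s : ℝ) :
    costDensity U w 0 ≤ costDensity U w s := by
  rw [costDensity_zero]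
  exact Finset.sum_le_sum fun i _ =>
    mul_le_mul_of_nonneg_left (two_mul_abs_le_abs_sub_add_abs_add s (U i)) (hw i)

theorem eq_zero_of_costDensity_le (hw : ∀ i, 0 ≤ w i) {i : ι} (hUi : U i = 0) (hwi : 0 < w i)
    {s : ℝ} (hs : costDensity U w s ≤ costDensity U w 0) : s = 0 := by
  by_contra hs0
  refine hs.not_gt ?_
  rw [costDensity_zero]
  refine Finset.sum_lt_sum (fun j _ => mul_le_mul_of_nonneg_left
    (two_mul_abs_le_abs_sub_add_abs_add s (U j)) (hw j)) ⟨i, Finset.mem_univ i, ?_⟩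
  refine mul_lt_mul_of_pos_left ?_ hwi
  rw [hUi, abs_zero, mul_zero, sub_zero, add_zero]
  exact add_pos (abs_pos.2 hs0) (abs_pos.2 hs0)

end CostDensity

section Reduction

variable {n N : ℕ} {A : Matrix (Fin n) (Fin n) ℝ} {B : Fin n → ℝ} {T : ℝ}
  {U w : Fin (N + 1) → ℝ} {ξ : Fin n → ℝ} {u : ℝ → ℝ}

theorem memLp_impulseResponse (A : Matrix (Fin n) (Fin n) ℝ) (B : Fin n → ℝ) (T : ℝ) :
    MemLp (impulseResponse A B) 2 (volume.restrict (Icc 0 T)) := by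
  have hc := continuous_impulseResponse A B
  obtain ⟨C, hC⟩ := isCompact_Icc.exists_bound_of_continuousOn (hc.continuousOn (s := Icc 0 T))
  exact MemLp.of_bound hc.aestronglyMeasurable C (ae_restrict_of_forall_mem measurableSet_Icc hC)

/-- The feasible controls for `ξ` as a subset of `L²(0, T)`: by variation of constants, the
terminal condition `x T = 0` is the moment condition `∫ e^{-At} B u(t) dt = -ξ`. -/
def feasibleLp (A : Matrix (Fin n) (Fin n) ℝ) (B : Fin n → ℝ) (T : ℝ) (ξ : Fin n → ℝ) :
    Set (Lp ℝ 2 (volume.restrict (Icc 0 T))) :=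
  {f ∈ controls (volume.restrict (Icc 0 T)) (Icc (-1) 1) |
    momentMap (memLp_impulseResponse A B T) f = -ξ}

theorem intervalIntegral_eq_setIntegral_Icc {E : Type*} [NormedAddCommGroup E] [NormedSpace ℝ E]
    {a b : ℝ} (hab : a ≤ b) (f : ℝ → E) : ∫ t in a..b, f t = ∫ t in Icc a b, f t := by
  rw [intervalIntegral.integral_of_le hab, integral_Icc_eq_integral_Ioc]

theorem boundedControl_one_iff :
    BoundedControl T 1 u ↔
      ∃ f ∈ controls (volume.restrict (Icc 0 T)) (Icc (-1) 1),
        u =ᵐ[volume.restrict (Icc 0 T)] f := by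
  constructor
  · rintro ⟨hu, hbound⟩
    refine exists_mem_controls_ae_eq (Metric.isBounded_Icc _ _) hu ?_
    filter_upwards [ae_le_eLpNormEssSup (f := u) (μ := volume.restrict (Icc 0 T))] with t ht
    rw [eLpNorm_exponent_top] at hbound
    have hle := ht.trans hbound
    rwa [← ofReal_norm, ENNReal.ofReal_le_ofReal_iff zero_le_one, Real.norm_eq_abs,
      abs_le] at hle
  · rintro ⟨f, hf, huf⟩
    refine ⟨(Lp.aestronglyMeasurable f).congr huf.symm, ?_⟩
    rw [eLpNorm_congr_ae huf, eLpNorm_exponent_top]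
    refine eLpNormEssSup_le_of_ae_bound ?_
    filter_upwards [hf] with t ht using abs_le.2 ht

theorem integral_smul_impulseResponse_eq (hT : 0 ≤ T) {f : Lp ℝ 2 (volume.restrict (Icc 0 T))}
    (huf : u =ᵐ[volume.restrict (Icc 0 T)] f) :
    ∫ t in (0 : ℝ)..T, u t • impulseResponse A B t =
      momentMap (memLp_impulseResponse A B T) f := by
  rw [intervalIntegral_eq_setIntegral_Icc hT, momentMap_apply]
  refine integral_congr_ae ?_
  filter_upwards [huf] with t ht
  rw [ht]

theorem mem_feasible_iff (hT : 0 ≤ T) :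
    u ∈ feasible A B T ξ ↔
      ∃ f ∈ feasibleLp A B T ξ, u =ᵐ[volume.restrict (Icc 0 T)] f := by
  have hiff : ∀ f : Lp ℝ 2 (volume.restrict (Icc 0 T)), u =ᵐ[volume.restrict (Icc 0 T)] f →
      ((∃ x, IsTrajectory A B T u x ∧ x 0 = ξ ∧ x T = 0) ↔
        momentMap (memLp_impulseResponse A B T) f = -ξ) := fun f huf => by
    rw [← integral_smul_impulseResponse_eq hT huf, exists_isTrajectory_iff hT]
    exact (intervalIntegrable_iff_integrableOn_Icc_of_le hT).2
      (((Lp.memLp f).integrable one_le_two).congr huf.symm)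
  constructor
  · rintro ⟨hu, hx⟩
    obtain ⟨f, hf, huf⟩ := boundedControl_one_iff.1 hu
    exact ⟨f, ⟨hf, (hiff f huf).1 hx⟩, huf⟩
  · rintro ⟨f, ⟨hf, hfξ⟩, huf⟩
    exact ⟨boundedControl_one_iff.2 ⟨f, hf, huf⟩, (hiff f huf).2 hfξ⟩

theorem feasibleLp_nonempty (hT : 0 ≤ T) (hξ : ξ ∈ reachable A B T) :
    (feasibleLp A B T ξ).Nonempty := by
  obtain ⟨u, hu, hξu⟩ := hξ
  obtain ⟨f, hf, huf⟩ := boundedControl_one_iff.1 hu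
  refine ⟨-f, ?_, ?_⟩
  · filter_upwards [hf, Lp.coeFn_neg f] with t ht hneg
    rw [hneg, Pi.neg_apply]
    exact ⟨neg_le_neg ht.2, neg_le.2 ht.1⟩
  · rw [map_neg, ← integral_smul_impulseResponse_eq hT huf, hξu]
    rfl

theorem l1Norm_eq_integral (hT : 0 ≤ T) (v : ℝ → ℝ) :
    l1Norm T v = ∫ t in Icc 0 T, |v t| :=
  intervalIntegral_eq_setIntegral_Icc hT _

theorem cost_eq_integral (hT : 0 ≤ T) (hu : Integrable u (volume.restrict (Icc 0 T))) :
    cost T U w u = ∫ t in Icc 0 T, costDensity U w (u t) := by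
  have hsub : ∀ i, Integrable (fun t => |u t - U i|) (volume.restrict (Icc 0 T)) := fun i =>
    (hu.sub (integrable_const (U i))).abs
  have hadd : ∀ i, Integrable (fun t => |u t + U i|) (volume.restrict (Icc 0 T)) := fun i =>
    (hu.add (integrable_const (U i))).abs
  have hterm : ∀ i, Integrable (fun t => w i * (|u t - U i| + |u t + U i|))
      (volume.restrict (Icc 0 T)) := fun i => ((hsub i).add (hadd i)).const_mul (w i)
  simp only [cost, costDensity, l1Norm_eq_integral hT]
  rw [integral_finsetSum _ fun i _ => hterm i]
  simp only [integral_const_mul, integral_add (hsub _) (hadd _)]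

theorem cost_eq_integral_of_ae_eq (hT : 0 ≤ T) {f : Lp ℝ 2 (volume.restrict (Icc 0 T))}
    (huf : u =ᵐ[volume.restrict (Icc 0 T)] f) :
    cost T U w u = ∫ t in Icc 0 T, costDensity U w (f t) := by
  rw [cost_eq_integral hT (((Lp.memLp f).integrable one_le_two).congr huf.symm)]
  refine integral_congr_ae ?_
  filter_upwards [huf] with t ht
  rw [ht]

theorem isOptimal_iff (hT : 0 ≤ T) :
    IsOptimal A B T U w ξ u ↔
      ∃ f ∈ feasibleLp A B T ξ,
        IsMinOn (fun f => ∫ t in Icc 0 T, costDensity U w (f t)) (feasibleLp A B T ξ) f ∧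
          u =ᵐ[volume.restrict (Icc 0 T)] f := by
  constructor
  · rintro ⟨hu, hmin⟩
    obtain ⟨f, hf, huf⟩ := (mem_feasible_iff hT).1 hu
    refine ⟨f, hf, fun g hg => ?_, huf⟩
    have hle := hmin g ((mem_feasible_iff hT).2 ⟨g, hg, ae_eq_refl _⟩)
    rwa [cost_eq_integral_of_ae_eq hT huf, cost_eq_integral_of_ae_eq hT (ae_eq_refl g)] at hle
  · rintro ⟨f, hf, hmin, huf⟩
    refine ⟨(mem_feasible_iff hT).2 ⟨f, hf, huf⟩, fun v hv => ?_⟩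
    obtain ⟨g, hg, hvg⟩ := (mem_feasible_iff hT).1 hv
    rw [cost_eq_integral_of_ae_eq hT huf, cost_eq_integral_of_ae_eq hT hvg]
    exact hmin hg

theorem exists_isMinOn_feasibleLp (hT : 0 ≤ T) (hw : ∀ i, 0 ≤ w i) (hξ : ξ ∈ reachable A B T) :
    ∃ f ∈ feasibleLp A B T ξ,
      IsMinOn (fun f => ∫ t in Icc 0 T, costDensity U w (f t)) (feasibleLp A B T ξ) f :=
  exists_isMinOn_integral_comp isCompact_Icc (convex_Icc _ _) continuous_costDensity
    (convexOn_costDensity hw (convex_Icc _ _)) _ (feasibleLp_nonempty hT hξ)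

theorem hasUniqueOptimal_of_forall_eq (hT : 0 ≤ T) {f : Lp ℝ 2 (volume.restrict (Icc 0 T))}
    (hf : f ∈ feasibleLp A B T ξ)
    (hmin : IsMinOn (fun f => ∫ t in Icc 0 T, costDensity U w (f t)) (feasibleLp A B T ξ) f)
    (huniq : ∀ g ∈ feasibleLp A B T ξ,
      IsMinOn (fun f => ∫ t in Icc 0 T, costDensity U w (f t)) (feasibleLp A B T ξ) g → g = f) :
    HasUniqueOptimal A B T U w ξ := by
  refine ⟨f, (isOptimal_iff hT).2 ⟨f, hf, hmin, ae_eq_refl _⟩, fun v hv => ?_⟩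
  obtain ⟨g, hg, hgmin, hvg⟩ := (isOptimal_iff hT).1 hv
  rwa [huniq g hg hgmin] at hvg

theorem eq_of_isMinOn_feasibleLp (hw : ∀ i, 0 ≤ w i) (hA : IsUnit A) (hAB : Controllable A B)
    {f g : Lp ℝ 2 (volume.restrict (Icc 0 T))} (hf : f ∈ feasibleLp A B T ξ)
    (hg : g ∈ feasibleLp A B T ξ)
    (hfmin : IsMinOn (fun f => ∫ t in Icc 0 T, costDensity U w (f t)) (feasibleLp A B T ξ) f)
    (hgmin : IsMinOn (fun f => ∫ t in Icc 0 T, costDensity U w (f t)) (feasibleLp A B T ξ) g)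
    (hglobal : ¬ IsMinOn (fun f => ∫ t in Icc 0 T, costDensity U w (f t))
      (controls (volume.restrict (Icc 0 T)) (Icc (-1) 1)) f) : f = g :=
  eq_of_isMinOn_of_not_isMinOn_controls isCompact_Icc (convex_Icc _ _) continuous_costDensity
    (convexOn_costDensity hw (convex_Icc _ _)) _
    (fun _ hp c => ae_restrict_of_ae (hAB.ae_apply_impulseResponse_ne hA hp c)) hf hg hfmin hgmin
    hglobal

theorem integral_costDensity_zero (hT : 0 ≤ T) (hU : ∀ i, 0 ≤ U i) :
    ∫ _ in Icc 0 T, costDensity U w 0 = costMin T U w := by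
  have hsum : ∑ i, w i * (2 * |U i|) = 2 * ∑ i, w i * U i := by
    rw [Finset.mul_sum]
    exact Finset.sum_congr rfl fun i _ => by rw [abs_of_nonneg (hU i), mul_left_comm]
  rw [setIntegral_const, Real.volume_real_Icc_of_le hT, costDensity_zero, hsum, costMin,
    smul_eq_mul]
  ring

theorem zero_mem_controls : (0 : Lp ℝ 2 (volume.restrict (Icc 0 T))) ∈
    controls (volume.restrict (Icc 0 T)) (Icc (-1) 1) := by
  filter_upwards [Lp.coeFn_zero ℝ 2 (volume.restrict (Icc 0 T))] with t ht
  rw [ht]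
  simp

theorem mem_reachableMin_of_isMinOn_controls (hT : 0 ≤ T) (hU : ∀ i, 0 ≤ U i)
    (hw : ∀ i, 0 ≤ w i) {f : Lp ℝ 2 (volume.restrict (Icc 0 T))} (hf : f ∈ feasibleLp A B T ξ)
    (hmin : IsMinOn (fun f => ∫ t in Icc 0 T, costDensity U w (f t))
      (controls (volume.restrict (Icc 0 T)) (Icc (-1) 1)) f) : ξ ∈ reachableMin A B T U w := by
  have hlower : ∀ g ∈ controls (volume.restrict (Icc 0 T)) (Icc (-1) 1),
      costMin T U w ≤ ∫ t in Icc 0 T, costDensity U w (g t) := fun g hg => by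
    rw [← integral_costDensity_zero hT hU]
    exact integral_mono (integrable_const _)
      (integrable_comp_of_mem_controls isCompact_Icc continuous_costDensity hg)
      fun t => costDensity_zero_le hw (g t)
  have hupper : ∫ t in Icc 0 T, costDensity U w (f t) ≤ costMin T U w := by
    rw [← integral_costDensity_zero hT hU]
    refine (hmin zero_mem_controls).trans_eq (integral_congr_ae ?_)
    filter_upwards [Lp.coeFn_zero ℝ 2 (volume.restrict (Icc 0 T))] with t ht
    rw [ht, Pi.zero_apply]
  refine ⟨⟨f, (mem_feasible_iff hT).2 ⟨f, hf, ae_eq_refl _⟩, ?_⟩, ?_⟩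
  · rw [cost_eq_integral_of_ae_eq hT (ae_eq_refl f)]
    exact hupper.antisymm (hlower f hf.1)
  · rintro _ ⟨v, hv, rfl⟩
    obtain ⟨g, hg, hvg⟩ := (mem_feasible_iff hT).1 hv
    rw [cost_eq_integral_of_ae_eq hT hvg]
    exact hlower g hg.1

theorem eq_zero_of_isMinOn_controls (hw : ∀ i, 0 ≤ w i) {i : Fin (N + 1)} (hUi : U i = 0)
    (hwi : 0 < w i) {f : Lp ℝ 2 (volume.restrict (Icc 0 T))}
    (hf : f ∈ controls (volume.restrict (Icc 0 T)) (Icc (-1) 1))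
    (hmin : IsMinOn (fun f => ∫ t in Icc 0 T, costDensity U w (f t))
      (controls (volume.restrict (Icc 0 T)) (Icc (-1) 1)) f) : f = 0 := by
  refine Lp.ext ?_
  filter_upwards [Lp.coeFn_zero ℝ 2 (volume.restrict (Icc 0 T)),
    ae_le_of_isMinOn_integral (H := fun _ => costDensity U w) (Metric.isBounded_Icc _ _)
      (fun g hg => integrable_comp_of_mem_controls isCompact_Icc continuous_costDensity hg)
      hf zero_mem_controls hmin] with t h0 hle
  rw [h0, Pi.zero_apply] at hle ⊢
  exact eq_zero_of_costDensity_le hw hUi hwi hle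

end Reduction

end SOAV

theorem theorem4_general {n N : ℕ} {A : Matrix (Fin n) (Fin n) ℝ} {B : Fin n → ℝ} {T : ℝ}
    (hT : 0 ≤ T) {U w : Fin (N + 1) → ℝ} (hU : ∀ i, 0 ≤ U i) (hw : ∀ i, 0 ≤ w i)
    (hA : IsUnit A) (hAB : SOAV.Controllable A B) :
    (∀ ξ ∈ SOAV.reachable A B T \ SOAV.reachableMin A B T U w,
      SOAV.HasUniqueOptimal A B T U w ξ) ∧
    ((∃ i, U i = 0 ∧ 0 < w i) →
      ∀ ξ ∈ SOAV.reachable A B T, SOAV.HasUniqueOptimal A B T U w ξ) := by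
  constructor
  · rintro ξ ⟨hξ, hξmin⟩
    obtain ⟨f, hf, hfmin⟩ := SOAV.exists_isMinOn_feasibleLp (U := U) hT hw hξ
    refine SOAV.hasUniqueOptimal_of_forall_eq hT hf hfmin fun g hg hgmin => ?_
    exact SOAV.eq_of_isMinOn_feasibleLp hw hA hAB hg hf hgmin hfmin fun hglobal =>
      hξmin (SOAV.mem_reachableMin_of_isMinOn_controls hT hU hw hg hglobal)
  · rintro ⟨i, hUi, hwi⟩ ξ hξ
    obtain ⟨f, hf, hfmin⟩ := SOAV.exists_isMinOn_feasibleLp (U := U) hT hw hξ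
    refine SOAV.hasUniqueOptimal_of_forall_eq hT hf hfmin fun g hg hgmin => ?_
    by_contra hgf
    have hg_global := not_imp_comm.1
      (SOAV.eq_of_isMinOn_feasibleLp hw hA hAB hg hf hgmin hfmin) hgf
    have hf_global := not_imp_comm.1
      (SOAV.eq_of_isMinOn_feasibleLp hw hA hAB hf hg hfmin hgmin) (Ne.symm hgf)
    rw [SOAV.eq_zero_of_isMinOn_controls hw hUi hwi hg.1 hg_global,
      SOAV.eq_zero_of_isMinOn_controls hw hUi hwi hf.1 hf_global] at hgf
    exact hgf rfl

theorem theorem4 (n N : ℕ) (A : Matrix (Fin n) (Fin n) ℝ) (B : Fin n → ℝ)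
    (T : ℝ) (hT : 0 < T)
    (U w : Fin (N + 1) → ℝ)
    (hU_nonneg : 0 ≤ U 0) (hU_mono : StrictMono U) (hU_last : U (Fin.last N) = 1)
    (hw_nonneg : ∀ i, 0 ≤ w i) (hw_first : 0 < w 0) (hw_sum : ∑ i, w i = 1)
    (hA : IsUnit A) (hAB : SOAV.Controllable A B) :
    (∀ ξ ∈ SOAV.reachable A B T \ SOAV.reachableMin A B T U w,
      SOAV.HasUniqueOptimal A B T U w ξ) ∧
    (U 0 = 0 → ∀ ξ ∈ SOAV.reachable A B T, SOAV.HasUniqueOptimal A B T U w ξ) :=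
  (theorem4_general hT.le (fun i => hU_nonneg.trans (hU_mono.monotone (Fin.zero_le i)))
    hw_nonneg hA hAB).imp_right fun h hU0 => h ⟨0, hU0, hw_first⟩
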